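/- Consider the switched stochastic process $\mathbf{x}_{k+1} = f_{u_k}(\mathbf{x}_k) + g_{u_k}(\mathbf{x}_k) + \mathbf{v}_k$ on $\mathbb{R}^n$, with finitely many modes $u_k \in U=\{1,\dots,m\}$, continuous maps $f_u$ (known) and $g_u$ (unknown), and independent noise terms $\mathbf{v}_k$ with a common law $p_v$. Let $T^u(B\mid x)$ be the probability that $f_u(x)+g_u(x)+\mathbf{v}\in B$. A switching strategy $\pi_{\mathbf x}$ maps every finite path $x_0\xrightarrow{u_0}x_1\cdots\xrightarrow{u_{k-1}}x_k$ (measurably) to a mode; with the initial state $x_0$ it determines a unique law $P$ of the infinite path. Let $X\subset\mathbb{R}^n$ be compact, let $r_1,\dots,r_\ell\subseteq X$ be closed regions of interest, let $L(x)=\{i : x\in r_i\}$, and let $\varphi$ be an LTL formula over finite traces (LTL$_f$) with atomic propositions $1,\dots,\ell$. A path satisfies $\varphi$ if some prefix $x_0,\dots,x_k$ lies entirely in $X$ and has a trace $L(x_0)\cdots L(x_k)$ that satisfies $\varphi$. Put $p^*(x)=\sup_{\pi_{\mathbf x}} P[\omega_{\mathbf x}\models\varphi\mid \pi_{\mathbf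 x},\omega_{\mathbf x}(0)=x]$. Let $X$ be partitioned into finitely many Borel cells, each of which is contained in or disjoint from every $r_i$. Let $Q$ consist of the cells and of one further state $q_{\mathsf u}=\mathbb{R}^n\setminus X$, and let $z:\mathbb{R}^n\to Q$ map $x$ to the $q$ with $x\in q$. Let $\mathcal I$ be an interval Markov decision process (IMDP) abstraction of the process: an IMDP with states $Q$, actions $U$ (all available in every state), labels $L(q)=L(x)$ for every cell $q$ and $x\in q$, and transition bounds $\check P\le\hat P$ with values in $[0,1]$ and $\sum_{q'}\check P(q,u,q')\le 1\le\sum_{q'}\hat P(q,u,q')$ such that $$\check P(q,u,q')\le T^u(q'\mid x)\le\hat P(q,u,q')\qquad\text{for all cells } q,\ x\in q,\ u\in U,\ q'\in Q,$$ and $\check P(q_{\mathsf u},u,q_{\mathsf u})=\hat P(q_{\mathsf u},u,q_{\mathsf u})=1$ for all $u\in U$. (The bounds may have been computed from a dataset by any method, for instance Gaussian process regression.) A strategy $\pi$ of $\mathcal I$ maps finite paths to actions; an adversary $\xi$ assigns to every finite path with last state $q$ and every action $u$ a probability distribution on $Q$ that lies between $\check P(q,u,\cdot)$ and $\hat P(q,u,\cdot)$.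 A path of $\mathcal I$ satisfies $\varphi$ if it has a prefix that does not visit $q_{\mathsf u}$ and whose trace satisfies $\varphi$. Let $\pi^\varepsilon$ be a strategy of $\mathcal I$ that maximizes $\inf_\xi P[\omega_{\mathcal I}\models\varphi\mid\pi,\xi,\omega_{\mathcal I}(0)=q]$ over all strategies $\pi$, for every $q\in Q$. Put $$\check p(q)=\inf_\xi P[\omega_{\mathcal I}\models\varphi\mid\pi^\varepsilon,\xi,\omega_{\mathcal I}(0)=q],\quad \hat p(q)=\sup_\xi P[\omega_{\mathcal I}\models\varphi\mid\pi^\varepsilon,\xi,\omega_{\mathcal I}(0)=q],\quad \hat p^*(q)=\sup_\pi\sup_\xi P[\omega_{\mathcal I}\models\varphi\mid\pi,\xi,\omega_{\mathcal I}(0)=q],$$ and let $\pi^\varepsilon_{\mathbf x}$ be the switching strategy $\pi^\varepsilon_{\mathbf x}(x_0\xrightarrow{u_0}\cdots\xrightarrow{u_{k-1}}x_k)=\pi^\varepsilon(z(x_0)\xrightarrow{u_0}\cdots\xrightarrow{u_{k-1}}z(x_k))$. Then, for every $x\in\mathbb{R}^n$, $$P[\omega_{\mathbf x}\models\varphi\mid\pi^\varepsilon_{\mathbf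 x},\omega_{\mathbf x}(0)=x]\in[\check p(z(x)),\hat p(z(x))]$$ and $$\bigl|P[\omega_{\mathbf x}\models\varphi\mid\pi^\varepsilon_{\mathbf x},\omega_{\mathbf x}(0)=x]-p^*(x)\bigr|\le\hat p^*(z(x))-\check p(z(x)).$$ -/

import Mathlib

open MeasureTheory ProbabilityTheory

/-! ## LTL over finite traces -/

/-- Syntax of LTL over finite traces, with atomic propositions `AP`. -/
inductive LTLf (AP : Type) : Type
  | top : LTLf AP
  | atom : AP → LTLf AP
  | neg : LTLf AP → LTLf AP
  | conj : LTLf AP → LTLf AP → LTLf AP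
  | next : LTLf AP → LTLf AP
  | untl : LTLf AP → LTLf AP → LTLf AP

/-- `LTLf.Holds ρ i φ`: the `i`-th step (counted from `0`) of the finite trace `ρ` is a
model of `φ`. -/
def LTLf.Holds {AP : Type} (ρ : List (Set AP)) : ℕ → LTLf AP → Prop
  | _, .top => True
  | i, .atom p => ∃ s, ρ[i]? = some s ∧ p ∈ s
  | i, .neg φ => ¬ LTLf.Holds ρ i φ
  | i, .conj φ ψ => LTLf.Holds ρ i φ ∧ LTLf.Holds ρ i ψ
  | i, .next φ => i + 1 < ρ.length ∧ LTLf.Holds ρ (i + 1) φ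
  | i, .untl φ ψ => ∃ j, i ≤ j ∧ j < ρ.length ∧ LTLf.Holds ρ j ψ ∧
      ∀ k, i ≤ k → k < j → LTLf.Holds ρ k φ

/-- The language of `φ`: the finite traces `ρ` with `ρ, 0 ⊨ φ`. -/
def LTLf.language {AP : Type} (φ : LTLf AP) : Set (List (Set AP)) :=
  {ρ | LTLf.Holds ρ 0 φ}

/-- The trace `L (ω 0), …, L (ω k)` of the prefix of `ω` ending at time `k`. -/
def tracePrefix {S AP : Type} (L : S → Set AP) (ω : ℕ → S) (k : ℕ) : List (Set AP) :=
  (List.range (k + 1)).map (fun i => L (ω i))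

/-- An infinite path satisfies `φ` if some prefix of it stays in `safe` and has its trace in
the language of `φ`. -/
def PathSat {S AP : Type} (safe : Set S) (L : S → Set AP) (φ : LTLf AP) (ω : ℕ → S) : Prop :=
  ∃ k, tracePrefix L ω k ∈ φ.language ∧ ∀ k' ≤ k, ω k' ∈ safe

/-! ## Strategies and the path measure of a controlled process -/

/-- A (history-dependent, deterministic) strategy: it maps every finite path
`x₀ -u₀→ x₁ -u₁→ ⋯ -u₍ₖ₋₁₎→ xₖ`, given by its states and its actions, to an action.
Measurability, needed for the path measure to exist, is automatic on finite discrete spaces. -/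
structure Strategy (S A : Type) [MeasurableSpace S] [MeasurableSpace A] where
  act : (k : ℕ) → (Finset.Iic k → S) → (Fin k → A) → A
  measurable_act : ∀ k,
    Measurable (fun p : (Finset.Iic k → S) × (Fin k → A) => act k p.1 p.2)

/-- The last state of a finite path. -/
def lastState {S : Type} {k : ℕ} (h : Finset.Iic k → S) : S :=
  h ⟨k, Finset.mem_Iic.2 le_rfl⟩

/-- The finite path with its last state removed. -/
def dropLastState {S : Type} {k : ℕ} (h : Finset.Iic (k + 1) → S) : Finset.Iic k → S :=
  fun i => h ⟨i.1, Finset.mem_Iic.2 ((Finset.mem_Iic.1 i.2).trans (Nat.le_succ k))⟩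

section Controlled

variable {S A : Type} [MeasurableSpace S] [MeasurableSpace A]

/-- The actions `u₀, …, u₍ₖ₋₁₎` that the strategy has taken along the states `x₀, …, xₖ`. -/
def Strategy.pastActions (π : Strategy S A) : (k : ℕ) → (Finset.Iic k → S) → (Fin k → A)
  | 0, _ => Fin.elim0
  | k + 1, h => Fin.snoc (α := fun _ => A) (π.pastActions k (dropLastState h))
      (π.act k (dropLastState h) (π.pastActions k (dropLastState h)))

theorem measurable_lastState {k : ℕ} :
    Measurable (lastState : (Finset.Iic k → S) → S) :=
  measurable_pi_apply _

theorem measurable_dropLastState {k : ℕ} :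
    Measurable (dropLastState : (Finset.Iic (k + 1) → S) → (Finset.Iic k → S)) :=
  measurable_pi_lambda _ (fun _ => measurable_pi_apply _)

theorem Strategy.measurable_pastActions (π : Strategy S A) :
    ∀ k, Measurable (π.pastActions k)
  | 0 => measurable_pi_lambda _ (fun i => i.elim0)
  | k + 1 => by
    have ih := (π.measurable_pastActions k).comp (measurable_dropLastState (S := S) (k := k))
    refine measurable_pi_lambda _ (fun i => ?_)
    refine Fin.lastCases ?_ (fun j => ?_) i
    · simp only [Strategy.pastActions, Fin.snoc_last]
      exact (π.measurable_act k).comp (measurable_dropLastState.prodMk ih)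
    · simp only [Strategy.pastActions, Fin.snoc_castSucc]
      exact (measurable_pi_apply j).comp ih

/-- The states, the past actions and the action chosen now, as a function of the states. -/
def Strategy.decision (π : Strategy S A) (k : ℕ) (h : Finset.Iic k → S) :
    (Finset.Iic k → S) × (Fin k → A) × A :=
  (h, π.pastActions k h, π.act k h (π.pastActions k h))

theorem Strategy.measurable_decision (π : Strategy S A) (k : ℕ) :
    Measurable (π.decision k) :=
  measurable_id.prodMk ((π.measurable_pastActions k).prodMk
    ((π.measurable_act k).comp (measurable_id.prodMk (π.measurable_pastActions k))))

/-- The law of the infinite path (Ionescu-Tulcea) that starts in `x₀` and whose next state,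
given the finite path so far and the action chosen by `π`, has the law `κ`. -/
noncomputable def pathMeasure (π : Strategy S A)
    (κ : (k : ℕ) → Kernel ((Finset.Iic k → S) × (Fin k → A) × A) S)
    [∀ k, IsMarkovKernel (κ k)] (x₀ : S) : Measure (ℕ → S) :=
  Kernel.traj (X := fun _ => S)
    (fun k => (κ k).comap (π.decision k) (π.measurable_decision k)) 0 (fun _ => x₀)

end Controlled

/-! ## The switched stochastic process -/

/-- The process `x_{k+1} = f_u (x_k) + g_u (x_k) + v_k` on `ℝⁿ` with modes `u ∈ {1, …, m}` and
independent noise terms `v_k` of law `noise`. -/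
structure SwitchedSystem (n m : ℕ) where
  f : Fin m → EuclideanSpace ℝ (Fin n) → EuclideanSpace ℝ (Fin n)
  g : Fin m → EuclideanSpace ℝ (Fin n) → EuclideanSpace ℝ (Fin n)
  continuous_f : ∀ u, Continuous (f u)
  continuous_g : ∀ u, Continuous (g u)
  noise : Measure (EuclideanSpace ℝ (Fin n))
  isProbabilityMeasure_noise : IsProbabilityMeasure noise

namespace SwitchedSystem

variable {n m : ℕ}

/-- The one-step map, as a function of the mode, the state and the noise. -/
def step (Sys : SwitchedSystem n m)
    (p : (Fin m × EuclideanSpace ℝ (Fin n)) × EuclideanSpace ℝ (Fin n)) :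
    EuclideanSpace ℝ (Fin n) :=
  Sys.f p.1.1 p.1.2 + Sys.g p.1.1 p.1.2 + p.2

theorem measurable_step (Sys : SwitchedSystem n m) : Measurable Sys.step := by
  have hf : Measurable (fun p : Fin m × EuclideanSpace ℝ (Fin n) => Sys.f p.1 p.2) :=
    measurable_from_prod_countable_right (fun u => (Sys.continuous_f u).measurable)
  have hg : Measurable (fun p : Fin m × EuclideanSpace ℝ (Fin n) => Sys.g p.1 p.2) :=
    measurable_from_prod_countable_right (fun u => (Sys.continuous_g u).measurable)
  exact ((hf.comp measurable_fst).add (hg.comp measurable_fst)).add measurable_snd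

/-- The stochastic transition function: `T (u, x)` is the law of `f_u x + g_u x + v`. -/
noncomputable def T (Sys : SwitchedSystem n m) :
    Kernel (Fin m × EuclideanSpace ℝ (Fin n)) (EuclideanSpace ℝ (Fin n)) where
  toFun p := Sys.noise.map (fun v => Sys.step (p, v))
  measurable' := by
    have := Sys.isProbabilityMeasure_noise
    refine Measure.measurable_of_measurable_coe _ (fun s hs => ?_)
    have h : ∀ p, (Sys.noise.map (fun v => Sys.step (p, v))) s
        = Sys.noise (Prod.mk p ⁻¹' (Sys.step ⁻¹' s)) := fun p =>
      Measure.map_apply (Sys.measurable_step.comp measurable_prodMk_left) hs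
    simp only [h]
    exact measurable_measure_prodMk_left (Sys.measurable_step hs)

instance (Sys : SwitchedSystem n m) : IsMarkovKernel Sys.T where
  isProbabilityMeasure _ :=
    have := Sys.isProbabilityMeasure_noise
    Measure.isProbabilityMeasure_map
      (Sys.measurable_step.comp measurable_prodMk_left).aemeasurable

/-- `T` as a function of the whole finite path and the current action. -/
noncomputable def transition (Sys : SwitchedSystem n m) (k : ℕ) :
    Kernel ((Finset.Iic k → EuclideanSpace ℝ (Fin n)) × (Fin k → Fin m) × Fin m)
      (EuclideanSpace ℝ (Fin n)) :=
  Sys.T.comap (fun p => (p.2.2, lastState p.1))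
    ((measurable_snd.comp measurable_snd).prodMk (measurable_lastState.comp measurable_fst))

instance (Sys : SwitchedSystem n m) (k : ℕ) : IsMarkovKernel (Sys.transition k) := by
  unfold transition; infer_instance

/-- The labelling function `L x = {i | x ∈ r i}` of the regions of interest. -/
def label {ℓ : ℕ} (r : Fin ℓ → Set (EuclideanSpace ℝ (Fin n)))
    (x : EuclideanSpace ℝ (Fin n)) : Set (Fin ℓ) :=
  {i | x ∈ r i}

/-- The probability that the process started in `x` satisfies `φ` under the strategy `π`. -/
noncomputable def satProb (Sys : SwitchedSystem n m) (X : Set (EuclideanSpace ℝ (Fin n)))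
    {ℓ : ℕ} (r : Fin ℓ → Set (EuclideanSpace ℝ (Fin n))) (φ : LTLf (Fin ℓ))
    (π : Strategy (EuclideanSpace ℝ (Fin n)) (Fin m)) (x : EuclideanSpace ℝ (Fin n)) : ℝ :=
  (pathMeasure π Sys.transition x).real {ω | PathSat X (label r) φ ω}

/-- The optimal satisfaction probability `p*(x)`, over all switching strategies. -/
noncomputable def optProb (Sys : SwitchedSystem n m) (X : Set (EuclideanSpace ℝ (Fin n)))
    {ℓ : ℕ} (r : Fin ℓ → Set (EuclideanSpace ℝ (Fin n))) (φ : LTLf (Fin ℓ))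
    (x : EuclideanSpace ℝ (Fin n)) : ℝ :=
  ⨆ π : Strategy (EuclideanSpace ℝ (Fin n)) (Fin m), Sys.satProb X r φ π x

end SwitchedSystem

/-! ## Interval Markov decision processes -/

/-- An interval Markov decision process with finite sets of states `Q`, of actions `A` and of
atomic propositions `AP`, in which every action is available in every state. -/
structure IMDP (Q A AP : Type) [Fintype Q] [Finite A] [Finite AP] where
  lower : Q → A → Q → ℝ
  upper : Q → A → Q → ℝ
  lower_nonneg : ∀ q a q', 0 ≤ lower q a q'
  upper_le_one : ∀ q a q', upper q a q' ≤ 1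
  lower_le_upper : ∀ q a q', lower q a q' ≤ upper q a q'
  sum_lower_le_one : ∀ q a, ∑ q', lower q a q' ≤ 1
  one_le_sum_upper : ∀ q a, 1 ≤ ∑ q', upper q a q'
  label : Q → Set AP

namespace IMDP

variable {Q A AP : Type} [Fintype Q] [Finite A] [Finite AP]

/-- An adversary assigns a feasible distribution to every finite path and action. -/
structure Adversary (I : IMDP Q A AP) where
  dist : (k : ℕ) → (Finset.Iic k → Q) → (Fin k → A) → A → PMF Q
  feasible : ∀ k h as a q',
    I.lower (lastState h) a q' ≤ (dist k h as a q').toReal ∧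
      (dist k h as a q').toReal ≤ I.upper (lastState h) a q'

variable [MeasurableSpace Q] [DiscreteMeasurableSpace Q]
  [MeasurableSpace A] [DiscreteMeasurableSpace A]

/-- The transition kernels of the chain that results from fixing the adversary. -/
noncomputable def Adversary.transition {I : IMDP Q A AP} (ξ : I.Adversary) (k : ℕ) :
    Kernel ((Finset.Iic k → Q) × (Fin k → A) × A) Q :=
  Kernel.ofFunOfCountable (fun p => (ξ.dist k p.1 p.2.1 p.2.2).toMeasure)

instance {I : IMDP Q A AP} (ξ : I.Adversary) (k : ℕ) : IsMarkovKernel (ξ.transition k) where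
  isProbabilityMeasure p :=
    PMF.toMeasure.isProbabilityMeasure (ξ.dist k p.1 p.2.1 p.2.2)

/-- The probability that a path of the IMDP started in `q` satisfies `φ`, by a prefix that
stays in `safe`, under the strategy `π` and the adversary `ξ`. -/
noncomputable def satProb (I : IMDP Q A AP) (safe : Set Q) (φ : LTLf AP)
    (π : Strategy Q A) (ξ : I.Adversary) (q : Q) : ℝ :=
  (pathMeasure π ξ.transition q).real {ω | PathSat safe I.label φ ω}

/-- The value of `π` against the worst adversary. -/
noncomputable def pLow (I : IMDP Q A AP) (safe : Set Q) (φ : LTLf AP)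
    (π : Strategy Q A) (q : Q) : ℝ :=
  ⨅ ξ : I.Adversary, I.satProb safe φ π ξ q

/-- The value of `π` with the best adversary. -/
noncomputable def pUp (I : IMDP Q A AP) (safe : Set Q) (φ : LTLf AP)
    (π : Strategy Q A) (q : Q) : ℝ :=
  ⨆ ξ : I.Adversary, I.satProb safe φ π ξ q

/-- The optimistic value: the best strategy with the best adversary. -/
noncomputable def pUpOpt (I : IMDP Q A AP) (safe : Set Q) (φ : LTLf AP) (q : Q) : ℝ :=
  ⨆ π : Strategy Q A, ⨆ ξ : I.Adversary, I.satProb safe φ π ξ q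

/-- `π` is a max-min strategy: it maximizes the value against the worst adversary, from every
initial state. -/
def IsRobustOptimal (I : IMDP Q A AP) (safe : Set Q) (φ : LTLf AP) (π : Strategy Q A) : Prop :=
  ∀ q, ∀ π' : Strategy Q A, I.pLow safe φ π' q ≤ I.pLow safe φ π q

end IMDP

/-! ## Discretization and abstraction -/

/-- The abstract states: the `N` cells `some i`, and `none` for the complement of `X`. -/
abbrev AbsState (N : ℕ) : Type := Option (Fin N)

instance (N : ℕ) : MeasurableSpace (AbsState N) := ⊤

instance (N : ℕ) : DiscreteMeasurableSpace (AbsState N) where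
  forall_measurableSet _ := trivial

/-- The abstract state of the `i`-th cell. -/
def AbsState.cell {N : ℕ} (i : Fin N) : AbsState N := some i

/-- The abstract state of the complement of `X`. -/
def AbsState.outside {N : ℕ} : AbsState N := none

/-- A partition of `X` into `N` Borel cells that respects the regions of interest. -/
structure Discretization {n ℓ : ℕ} (X : Set (EuclideanSpace ℝ (Fin n)))
    (r : Fin ℓ → Set (EuclideanSpace ℝ (Fin n))) (N : ℕ) where
  cell : Fin N → Set (EuclideanSpace ℝ (Fin n))
  measurableSet_cell : ∀ i, MeasurableSet (cell i)
  disjoint_cell : ∀ i j, i ≠ j → Disjoint (cell i) (cell j)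
  iUnion_cell : ⋃ i, cell i = X
  respects : ∀ i j, cell i ⊆ r j ∨ Disjoint (cell i) (r j)

namespace Discretization

variable {n ℓ N : ℕ} {X : Set (EuclideanSpace ℝ (Fin n))}
  {r : Fin ℓ → Set (EuclideanSpace ℝ (Fin n))}

/-- The subset of `ℝⁿ` that an abstract state stands for. -/
def region (D : Discretization X r N) : AbsState N → Set (EuclideanSpace ℝ (Fin n))
  | some i => D.cell i
  | none => Xᶜ

open Classical in
/-- The map from states to abstract states; `mem_region_iff` is its defining property. -/
noncomputable def z (D : Discretization X r N) (x : EuclideanSpace ℝ (Fin n)) : AbsState N :=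
  if h : ∃ i, x ∈ D.cell i then AbsState.cell h.choose else AbsState.outside

theorem mem_region_iff (D : Discretization X r N) (x : EuclideanSpace ℝ (Fin n))
    (q : AbsState N) : x ∈ D.region q ↔ D.z x = q := by
  have hX : x ∈ X ↔ ∃ i, x ∈ D.cell i := by
    simpa using (Set.ext_iff.1 D.iUnion_cell x).symm
  unfold z
  by_cases h : ∃ i, x ∈ D.cell i
  · rw [dif_pos h]
    cases q with
    | none => simpa [region, AbsState.cell, hX] using h
    | some i =>
      constructor
      · intro hi
        by_contra hne
        have : h.choose ≠ i := fun e => hne (congrArg some e)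
        exact Set.disjoint_left.1 (D.disjoint_cell _ _ this) h.choose_spec hi
      · intro e
        have : h.choose = i := Option.some.inj e
        exact this ▸ h.choose_spec
  · rw [dif_neg h]
    cases q with
    | none => exact ⟨fun _ => rfl, fun _ hx => h (hX.1 hx)⟩
    | some i =>
      constructor
      · exact fun hi => absurd ⟨i, hi⟩ h
      · exact fun e => nomatch e

theorem measurable_z (D : Discretization X r N) : Measurable D.z := by
  have hcell : ∀ q, MeasurableSet (D.region q) := by
    intro q
    cases q with
    | none =>
      have : MeasurableSet X := by
        have hU := MeasurableSet.iUnion D.measurableSet_cell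
        rwa [D.iUnion_cell] at hU
      exact this.compl
    | some i => exact D.measurableSet_cell i
  refine measurable_to_countable' (fun q => ?_)
  have : D.z ⁻¹' {q} = D.region q := by
    ext x
    exact (D.mem_region_iff x q).symm
  rw [this]
  exact hcell q

/-- The switching strategy obtained from a strategy on the abstract states: a finite path of
the process is mapped, state by state, to a path of abstract states with the same actions. -/
noncomputable def refine (D : Discretization X r N) {m : ℕ} (π : Strategy (AbsState N) (Fin m)) :
    Strategy (EuclideanSpace ℝ (Fin n)) (Fin m) where
  act k h as := π.act k (fun i => D.z (h i)) as
  measurable_act k := (π.measurable_act k).comp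
    ((measurable_pi_lambda _ (fun i => D.measurable_z.comp
      ((measurable_pi_apply i).comp measurable_fst))).prodMk measurable_snd)

/-- `I` is an IMDP abstraction of the process on the discretization `D`: its labels are those
of the points of the cells, its intervals contain the true transition probabilities from all
points of the cells, and the state outside `X` is absorbing. -/
structure IsAbstraction {m : ℕ} (D : Discretization X r N) (Sys : SwitchedSystem n m)
    (I : IMDP (AbsState N) (Fin m) (Fin ℓ)) : Prop where
  label_eq : ∀ i, ∀ x ∈ D.cell i, I.label (AbsState.cell i) = SwitchedSystem.label r x
  lower_le : ∀ i u q', ∀ x ∈ D.cell i,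
    I.lower (AbsState.cell i) u q' ≤ (Sys.T (u, x)).real (D.region q')
  le_upper : ∀ i u q', ∀ x ∈ D.cell i,
    (Sys.T (u, x)).real (D.region q') ≤ I.upper (AbsState.cell i) u q'
  lower_outside : ∀ u, I.lower AbsState.outside u AbsState.outside = 1
  upper_outside : ∀ u, I.upper AbsState.outside u AbsState.outside = 1

end Discretization

/-! Satisfaction is witnessed by a finite prefix inside `X`, and the cells respect the labels. It is
therefore an event about the abstracted path `i ↦ z (ω i)`, and it depends only on abstract prefixes
that avoid `outside`. This matters because the process may return to `X`, while the abstract state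
`outside` is absorbing, so the two can be compared only until the first exit.

Bounds for the refined strategy. One adversary reproduces the process: after an abstract path `h`
and an action `u`, it plays the mean of `T^u(· | ω k)` over the process paths abstracted to `h`. All
these `ω k` lie in one cell, so this is an average of feasible vectors, and the interval constraints
are convex. By induction on the length, every safe finite path has the same probability in both
models (`exists_adversary_measure_cylinder`). Satisfaction is a countable disjoint union of
cylinders of safe paths, so the two satisfaction probabilities are equal
(`exists_adversary_satProb_eq`). The value therefore lies between the infimum and the supremum over
adversaries.

Bound on `p*`. An arbitrary switching strategy may act differently at two points of one cell, so
averaging does not yield a deterministic abstract strategy. Dynamic programming is used instead: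
`optValue` is the finite-horizon optimum over actions and feasible distributions. Along any strategy
of the process it is a supermartingale (`lintegral_optValue_le`), and in the IMDP a greedy strategy
and adversary attain it (`lintegral_optValue_greedy`). Letting the horizon grow gives `p* ≤ pUpOpt`.

The refined strategy competes in the supremum `p*`, so its value and `p*` both lie in the interval
from `pLow` to `pUpOpt`. -/

/-! ## Prolonging finite paths -/

/-- The finite path `h` prolonged by the state `y`. -/
def snocState {S : Type} {k : ℕ} (h : Finset.Iic k → S) (y : S) : Finset.Iic (k + 1) → S :=
  fun i => if hi : i.1 ≤ k then h ⟨i.1, Finset.mem_Iic.2 hi⟩ else y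

section SnocState

variable {S Q : Type}

@[simp]
theorem dropLastState_snocState {k : ℕ} (h : Finset.Iic k → S) (y : S) :
    dropLastState (snocState h y) = h := by
  ext i
  simp [dropLastState, snocState, Finset.mem_Iic.1 i.2]

@[simp]
theorem lastState_snocState {k : ℕ} (h : Finset.Iic k → S) (y : S) :
    lastState (snocState h y) = y := by
  simp [lastState, snocState]

theorem snocState_dropLastState {k : ℕ} (h : Finset.Iic (k + 1) → S) :
    snocState (dropLastState h) (lastState h) = h := by
  ext i
  by_cases hi : i.1 ≤ k
  · simp [dropLastState, snocState, hi]
  · have : i.1 = k + 1 := le_antisymm (Finset.mem_Iic.1 i.2) (by lia)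
    simp only [lastState, snocState, hi, dite_false]
    congr 1
    exact Subtype.ext this.symm

theorem snocState_eq_iff {k : ℕ} (h : Finset.Iic k → S) (y : S) (h' : Finset.Iic (k + 1) → S) :
    snocState h y = h' ↔ h = dropLastState h' ∧ y = lastState h' := by
  constructor
  · rintro rfl
    simp
  · rintro ⟨rfl, rfl⟩
    exact snocState_dropLastState h'

theorem comp_snocState (z : S → Q) {k : ℕ} (h : Finset.Iic k → S) (y : S) :
    (fun i => z (snocState h y i)) = snocState (fun i => z (h i)) (z y) := by
  ext i
  by_cases hi : i.1 ≤ k <;> simp [snocState, hi]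

theorem frestrictLe₂_snocState {j k : ℕ} (hj : j ≤ k) (h : Finset.Iic k → S) (y : S) :
    Preorder.frestrictLe₂ (π := fun _ => S) (hj.trans (Nat.le_succ k)) (snocState h y) =
      Preorder.frestrictLe₂ (π := fun _ => S) hj h := by
  ext i
  simp [snocState, (Finset.mem_Iic.1 i.2).trans hj]

theorem measurable_snocState [MeasurableSpace S] {k : ℕ} :
    Measurable (fun p : (Finset.Iic k → S) × S => snocState p.1 p.2) := by
  refine measurable_pi_lambda _ (fun i => ?_)
  by_cases hi : i.1 ≤ k
  · simpa [snocState, hi] using measurable_fst.eval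
  · simpa [snocState, hi] using measurable_snd

end SnocState

/-! ## One step of the path measure -/

section PathMeasure

variable {S A : Type} [MeasurableSpace S] [MeasurableSpace A] (π : Strategy S A)
  (κ : (k : ℕ) → Kernel ((Finset.Iic k → S) × (Fin k → A) × A) S) [∀ k, IsMarkovKernel (κ k)]
  (x₀ : S)

instance : IsProbabilityMeasure (pathMeasure π κ x₀) := by
  unfold pathMeasure; infer_instance

theorem map_frestrictLe_pathMeasure (k : ℕ) :
    (pathMeasure π κ x₀).map (Preorder.frestrictLe (π := fun _ => S) k) =
      Kernel.partialTraj (X := fun _ => S)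
        (fun k => (κ k).comap (π.decision k) (π.measurable_decision k)) 0 k (fun _ => x₀) :=
  Kernel.traj_map_frestrictLe_apply (X := fun _ => S) _ _ _

theorem lintegral_pathMeasure_zero {F : (Finset.Iic 0 → S) → ENNReal} (hF : Measurable F) :
    ∫⁻ ω, F (Preorder.frestrictLe (π := fun _ => S) 0 ω) ∂(pathMeasure π κ x₀) =
      F (fun _ => x₀) := by
  rw [← lintegral_map hF (Preorder.measurable_frestrictLe (X := fun _ => S) 0),
    map_frestrictLe_pathMeasure, Kernel.partialTraj_self, Kernel.id_apply,
    lintegral_dirac' _ hF]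

/-- The law of the path up to time `k + 1` in terms of the path up to time `k`. -/
theorem lintegral_pathMeasure_succ (k : ℕ) {F : (Finset.Iic (k + 1) → S) → ENNReal}
    (hF : Measurable F) :
    ∫⁻ ω, F (Preorder.frestrictLe (π := fun _ => S) (k + 1) ω) ∂(pathMeasure π κ x₀) =
      ∫⁻ ω, ∫⁻ y, F (snocState (Preorder.frestrictLe (π := fun _ => S) k ω) y)
        ∂(κ k (π.decision k (Preorder.frestrictLe (π := fun _ => S) k ω)))
          ∂(pathMeasure π κ x₀) := by
  have hG : Measurable (fun h : Finset.Iic k → S =>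
      ∫⁻ y, F (snocState h y) ∂(κ k (π.decision k h))) :=
    Measurable.lintegral_kernel_prod_right'
      (κ := (κ k).comap (π.decision k) (π.measurable_decision k))
      (hF.comp measurable_snocState)
  have hI : Measurable (IicProdIoc (X := fun _ => S) k (k + 1)) := measurable_IicProdIoc
  have hFI : Measurable (fun p => F (IicProdIoc (X := fun _ => S) k (k + 1) p)) := hF.comp hI
  -- The law up to `k + 1` is the law up to `k` followed by one kernel step. `IicProdIoc` glues the
  -- new state onto the old path, which is what `snocState` does.
  rw [← lintegral_map hF (Preorder.measurable_frestrictLe (X := fun _ => S) (k + 1)),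
    ← lintegral_map hG (Preorder.measurable_frestrictLe (X := fun _ => S) k),
    map_frestrictLe_pathMeasure, map_frestrictLe_pathMeasure,
    Kernel.partialTraj_succ_of_le (Nat.zero_le k), Kernel.lintegral_map _ hI _ hF,
    Kernel.lintegral_comp _ _ _ hFI]
  refine lintegral_congr (fun h => ?_)
  have hFh : Measurable (fun b => F (IicProdIoc (X := fun _ => S) k (k + 1) (h, b))) :=
    hFI.comp measurable_prodMk_left
  rw [Kernel.lintegral_id_prod hFI, Kernel.lintegral_map _
    (MeasurableEquiv.piSingleton (X := fun _ => S) k).measurable _ hFh, Kernel.comap_apply]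
  refine lintegral_congr (fun y => congrArg F (funext fun i => ?_))
  by_cases hi : i.1 ≤ k
  · simp [_root_.IicProdIoc, snocState, hi]
  · simp [_root_.IicProdIoc, snocState, hi, MeasurableEquiv.piSingleton]

end PathMeasure

/-! ## Satisfaction in terms of finite paths -/

/-- The finite path `h` stays in `safe` and its trace is in the language of `φ`. -/
def Accepts {S AP : Type} (safe : Set S) (L : S → Set AP) (φ : LTLf AP) (k : ℕ)
    (h : Finset.Iic k → S) : Prop :=
  -- On this range `min i k` equals `i`; the truncation only supplies the proof that the index is at
  -- most `k`.
  (List.range (k + 1)).map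
      (fun i => L (h ⟨min i k, Finset.mem_Iic.2 (min_le_right i k)⟩)) ∈ φ.language ∧
    ∀ i, h i ∈ safe

section Accepts

variable {S AP : Type} {safe : Set S} {L : S → Set AP} {φ : LTLf AP}

theorem pathSat_iff_accepts (ω : ℕ → S) :
    PathSat safe L φ ω ↔
      ∃ k, Accepts safe L φ k (Preorder.frestrictLe (π := fun _ => S) k ω) := by
  refine exists_congr (fun k => and_congr ?_ ?_)
  · have : tracePrefix L ω k = (List.range (k + 1)).map (fun i => L (ω (min i k))) := by
      refine List.map_congr_left (fun i hi => ?_)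
      rw [min_eq_left (Nat.lt_succ_iff.1 (List.mem_range.1 hi))]
    rw [this]
    rfl
  · exact ⟨fun H i => H i.1 (Finset.mem_Iic.1 i.2), fun H i hi => H ⟨i, Finset.mem_Iic.2 hi⟩⟩

/-- Some prefix of the finite path `h` is accepted. -/
def AcceptsBy (safe : Set S) (L : S → Set AP) (φ : LTLf AP) (k : ℕ)
    (h : Finset.Iic k → S) : Prop :=
  ∃ j, ∃ hj : j ≤ k, Accepts safe L φ j (Preorder.frestrictLe₂ (π := fun _ => S) hj h)

theorem acceptsBy_frestrictLe_iff (k : ℕ) (ω : ℕ → S) :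
    AcceptsBy safe L φ k (Preorder.frestrictLe (π := fun _ => S) k ω) ↔
      ∃ j ≤ k, Accepts safe L φ j (Preorder.frestrictLe (π := fun _ => S) j ω) :=
  ⟨fun ⟨j, hj, H⟩ => ⟨j, hj, H⟩, fun ⟨j, hj, H⟩ => ⟨j, hj, H⟩⟩

theorem not_safe_snocState {k : ℕ} {h : Finset.Iic k → S} (hs : ¬ ∀ i, h i ∈ safe) (y : S) :
    ¬ ∀ i, snocState h y i ∈ safe := by
  refine fun H => hs (fun i => ?_)
  have := H ⟨i.1, Finset.mem_Iic.2 ((Finset.mem_Iic.1 i.2).trans (Nat.le_succ k))⟩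
  simpa [snocState, Finset.mem_Iic.1 i.2] using this

/-- An acceptance at time `k + 1` would need the whole path to be safe, so once a path has left
`safe` its acceptance status is frozen. -/
theorem acceptsBy_snocState {k : ℕ} {h : Finset.Iic k → S} (hs : ¬ ∀ i, h i ∈ safe) (y : S) :
    AcceptsBy safe L φ (k + 1) (snocState h y) ↔ AcceptsBy safe L φ k h := by
  constructor
  · rintro ⟨j, hj, H⟩
    rcases Nat.lt_or_ge k j with hkj | hjk
    · refine absurd (fun i => ?_) hs
      have := H.2 ⟨i.1, Finset.mem_Iic.2 ((Finset.mem_Iic.1 i.2).trans hkj.le)⟩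
      simpa [snocState, Finset.mem_Iic.1 i.2] using this
    · exact ⟨j, hjk, by rwa [frestrictLe₂_snocState hjk] at H⟩
  · rintro ⟨j, hj, H⟩
    exact ⟨j, hj.trans (Nat.le_succ k), by rwa [frestrictLe₂_snocState hj]⟩

/-- The finite path `h` is accepted and no shorter prefix of it is. -/
def FirstAccepts (safe : Set S) (L : S → Set AP) (φ : LTLf AP) (k : ℕ)
    (h : Finset.Iic k → S) : Prop :=
  Accepts safe L φ k h ∧
    ∀ j (hj : j < k), ¬ Accepts safe L φ j (Preorder.frestrictLe₂ (π := fun _ => S) hj.le h)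

/-- Each satisfying path is sorted by its shortest accepted prefix. Minimality makes the cylinders
disjoint, and for countable `S` there are countably many of them, which gives measurability and a
series for the probability. -/
theorem setOf_pathSat_eq_iUnion :
    {ω : ℕ → S | PathSat safe L φ ω} =
      ⋃ p : {p : (k : ℕ) × (Finset.Iic k → S) // FirstAccepts safe L φ p.1 p.2},
        {ω | Preorder.frestrictLe (π := fun _ => S) p.1.1 ω = p.1.2} := by
  classical
  ext ω
  simp only [Set.mem_ofPred_eq, Set.mem_iUnion, pathSat_iff_accepts]
  constructor
  · intro H
    exact ⟨⟨⟨Nat.find H, Preorder.frestrictLe _ ω⟩, Nat.find_spec H,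
      fun j hj => Nat.find_min H hj⟩, rfl⟩
  · rintro ⟨⟨⟨k, h⟩, hf⟩, hω⟩
    obtain rfl : Preorder.frestrictLe (π := fun _ => S) k ω = h := hω
    exact ⟨k, hf.1⟩

theorem pairwise_disjoint_firstAccepts :
    Pairwise (Function.onFun Disjoint
      (fun p : {p : (k : ℕ) × (Finset.Iic k → S) // FirstAccepts safe L φ p.1 p.2} =>
        {ω : ℕ → S | Preorder.frestrictLe (π := fun _ => S) p.1.1 ω = p.1.2})) := by
  rintro ⟨⟨k, h⟩, hf⟩ ⟨⟨k', h'⟩, hf'⟩ hne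
  refine Set.disjoint_left.2 ?_
  intro ω hω hω'
  obtain rfl : Preorder.frestrictLe (π := fun _ => S) k ω = h := hω
  obtain rfl : Preorder.frestrictLe (π := fun _ => S) k' ω = h' := hω'
  rcases lt_trichotomy k k' with hk | rfl | hk
  · exact hf'.2 k hk hf.1
  · exact hne rfl
  · exact hf.2 k' hk hf'.1

theorem measurableSet_frestrictLe_eq [MeasurableSpace S] [MeasurableSingletonClass S] (k : ℕ)
    (h : Finset.Iic k → S) :
    MeasurableSet {ω : ℕ → S | Preorder.frestrictLe (π := fun _ => S) k ω = h} :=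
  Preorder.measurable_frestrictLe (X := fun _ => S) k (measurableSet_singleton h)

theorem measurableSet_pathSat [MeasurableSpace S] [MeasurableSingletonClass S] [Countable S] :
    MeasurableSet {ω : ℕ → S | PathSat safe L φ ω} := by
  rw [setOf_pathSat_eq_iUnion]
  exact MeasurableSet.iUnion (fun p => measurableSet_frestrictLe_eq p.1.1 p.1.2)

/-- Measures that agree on the cylinders of safe finite paths give the same probability to
satisfaction. -/
theorem measure_pathSat_congr [MeasurableSpace S] [MeasurableSingletonClass S] [Countable S]
    {μ ν : Measure (ℕ → S)}
    (H : ∀ k (h : Finset.Iic k → S), (∀ i, h i ∈ safe) →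
      μ {ω | Preorder.frestrictLe (π := fun _ => S) k ω = h} =
        ν {ω | Preorder.frestrictLe (π := fun _ => S) k ω = h}) :
    μ {ω | PathSat safe L φ ω} = ν {ω | PathSat safe L φ ω} := by
  rw [setOf_pathSat_eq_iUnion,
    measure_iUnion pairwise_disjoint_firstAccepts
      (fun p => measurableSet_frestrictLe_eq p.1.1 p.1.2),
    measure_iUnion pairwise_disjoint_firstAccepts
      (fun p => measurableSet_frestrictLe_eq p.1.1 p.1.2)]
  -- An accepted path is safe by definition, so agreement on safe cylinders is enough.
  exact tsum_congr (fun p => H _ _ p.2.1.2)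

/-- The probability of satisfaction is the supremum of those within a finite horizon. -/
theorem measure_pathSat_eq_iSup [MeasurableSpace S] (μ : Measure (ℕ → S)) :
    μ {ω | PathSat safe L φ ω} =
      ⨆ k, μ {ω | AcceptsBy safe L φ k (Preorder.frestrictLe (π := fun _ => S) k ω)} := by
  rw [← Monotone.measure_iUnion]
  · congr 1
    ext ω
    simp only [Set.mem_ofPred_eq, Set.mem_iUnion, pathSat_iff_accepts, acceptsBy_frestrictLe_iff]
    exact ⟨fun ⟨k, H⟩ => ⟨k, k, le_rfl, H⟩, fun ⟨_, j, _, H⟩ => ⟨j, H⟩⟩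
  · intro k k' hk ω
    simp only [Set.mem_ofPred_eq, acceptsBy_frestrictLe_iff]
    exact fun ⟨j, hj, H⟩ => ⟨j, hj.trans hk, H⟩

end Accepts

/-! ## Feasible distributions -/

namespace IMDP

variable {Q A AP : Type} [Fintype Q] [Finite A] [Finite AP]

/-- The distributions that the adversary may choose in `q` under the action `a`. -/
def Feasible (I : IMDP Q A AP) (q : Q) (a : A) (d : PMF Q) : Prop :=
  ∀ q', I.lower q a q' ≤ (d q').toReal ∧ (d q').toReal ≤ I.upper q a q'

/-- The feasible distributions as real vectors. -/
def feasibleSet (I : IMDP Q A AP) (q : Q) (a : A) : Set (Q → ℝ) :=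
  Set.Icc (I.lower q a) (I.upper q a) ∩ {v | ∑ q', v q' = 1}

theorem isCompact_feasibleSet (I : IMDP Q A AP) (q : Q) (a : A) :
    IsCompact (I.feasibleSet q a) :=
  isCompact_Icc.inter_right
    (isClosed_eq (continuous_finsetSum _ fun q' _ => continuous_apply q') continuous_const)

/-- On the segment from the lower to the upper bounds the total mass varies continuously from at
most `1` to at least `1`. -/
theorem nonempty_feasibleSet (I : IMDP Q A AP) (q : Q) (a : A) :
    (I.feasibleSet q a).Nonempty := by
  let f : ℝ → ℝ := fun t => ∑ q', (I.lower q a q' + t * (I.upper q a q' - I.lower q a q'))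
  have hf : ContinuousOn f (Set.Icc 0 1) := by fun_prop
  obtain ⟨t, ht, ht1⟩ : (1 : ℝ) ∈ f '' Set.Icc 0 1 :=
    intermediate_value_Icc zero_le_one hf
      ⟨by simpa [f] using I.sum_lower_le_one q a, by simpa [f] using I.one_le_sum_upper q a⟩
  refine ⟨fun q' => I.lower q a q' + t * (I.upper q a q' - I.lower q a q'), ⟨?_, ?_⟩, ht1⟩
  · intro q'
    have := mul_nonneg ht.1 (sub_nonneg.2 (I.lower_le_upper q a q'))
    simpa using this
  · intro q'
    have := mul_le_mul_of_nonneg_right ht.2 (sub_nonneg.2 (I.lower_le_upper q a q'))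
    simp only
    linarith

theorem exists_feasible_eq (I : IMDP Q A AP) {q : Q} {a : A} {v : Q → ℝ}
    (hv : v ∈ I.feasibleSet q a) : ∃ d : PMF Q, I.Feasible q a d ∧ ∀ q', (d q').toReal = v q' := by
  have h0 : ∀ q', 0 ≤ v q' := fun q' => (I.lower_nonneg q a q').trans (hv.1.1 q')
  have hd : ∑ q', ENNReal.ofReal (v q') = 1 := by
    rw [← ENNReal.ofReal_sum_of_nonneg (fun q' _ => h0 q'), hv.2, ENNReal.ofReal_one]
  have hval : ∀ q', (PMF.ofFintype _ hd q').toReal = v q' := fun q' => by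
    rw [PMF.ofFintype_apply, ENNReal.toReal_ofReal (h0 q')]
  exact ⟨PMF.ofFintype _ hd,
    fun q' => ⟨(hv.1.1 q').trans_eq (hval q').symm, (hval q').trans_le (hv.1.2 q')⟩, hval⟩

theorem exists_feasible (I : IMDP Q A AP) (q : Q) (a : A) : ∃ d : PMF Q, I.Feasible q a d := by
  obtain ⟨v, hv⟩ := I.nonempty_feasibleSet q a
  obtain ⟨d, hd, -⟩ := I.exists_feasible_eq hv
  exact ⟨d, hd⟩

theorem nonempty_adversary (I : IMDP Q A AP) : Nonempty I.Adversary :=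
  ⟨⟨fun _ h _ a => (I.exists_feasible (lastState h) a).choose,
    fun _ h _ a => (I.exists_feasible (lastState h) a).choose_spec⟩⟩

variable [MeasurableSpace Q] [DiscreteMeasurableSpace Q]

/-- Some feasible distribution maximizes the expectation of `V`. -/
theorem exists_feasible_forall_lintegral_le (I : IMDP Q A AP) (q : Q) (a : A) (V : Q → ENNReal) :
    ∃ d : PMF Q, I.Feasible q a d ∧ ((∀ q', V q' ≠ ⊤) →
      ∀ ν : Measure Q, IsProbabilityMeasure ν →
        (∀ q', I.lower q a q' ≤ ν.real {q'} ∧ ν.real {q'} ≤ I.upper q a q') →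
          ∫⁻ q', V q' ∂ν ≤ ∫⁻ q', V q' ∂d.toMeasure) := by
  -- A linear functional attains its maximum on the compact feasible polytope. Using `toReal` keeps
  -- this meaningful for every `V`; finiteness of `V` is needed only to compare integrals.
  obtain ⟨v, hv, hmax⟩ := (I.isCompact_feasibleSet q a).exists_isMaxOn
    (I.nonempty_feasibleSet q a)
    (f := fun v => ∑ q', (V q').toReal * v q') (by fun_prop)
  obtain ⟨d, hd, hdv⟩ := I.exists_feasible_eq hv
  refine ⟨d, hd, fun hV ν hν hfeas => ?_⟩
  have key : ∀ (μ : Measure Q) [IsProbabilityMeasure μ], ∫⁻ q', V q' ∂μ =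
      ENNReal.ofReal (∑ q', (V q').toReal * μ.real {q'}) := fun μ _ => by
    rw [lintegral_fintype, ENNReal.ofReal_sum_of_nonneg (fun q' _ => by positivity)]
    refine Finset.sum_congr rfl (fun q' _ => ?_)
    rw [ENNReal.ofReal_mul ENNReal.toReal_nonneg, ENNReal.ofReal_toReal (hV q'),
      ofReal_measureReal]
  rw [key, key]
  refine ENNReal.ofReal_le_ofReal ?_
  have hsum : ∑ q', ν.real {q'} = 1 := by
    simp
  have := hmax (a := fun q' => ν.real {q'})
    ⟨⟨fun q' => (hfeas q').1, fun q' => (hfeas q').2⟩, hsum⟩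
  refine this.trans_eq (Finset.sum_congr rfl fun q' _ => ?_)
  rw [Measure.real, PMF.toMeasure_apply_singleton _ _ (measurableSet_singleton q'), hdv]

end IMDP

/-! ## Optimistic values by backward induction -/

namespace IMDP

variable {Q A AP : Type} [Fintype Q] [Finite A] [Finite AP]
  [MeasurableSpace Q] [DiscreteMeasurableSpace Q]

/-- A feasible distribution that maximizes the expectation of `V`. -/
noncomputable def bestDist (I : IMDP Q A AP) (q : Q) (a : A) (V : Q → ENNReal) : PMF Q :=
  (I.exists_feasible_forall_lintegral_le q a V).choose

theorem feasible_bestDist (I : IMDP Q A AP) (q : Q) (a : A) (V : Q → ENNReal) :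
    I.Feasible q a (I.bestDist q a V) :=
  (I.exists_feasible_forall_lintegral_le q a V).choose_spec.1

theorem lintegral_le_bestDist (I : IMDP Q A AP) (q : Q) (a : A) {V : Q → ENNReal}
    (hV : ∀ q', V q' ≠ ⊤) (ν : Measure Q) [IsProbabilityMeasure ν]
    (hν : ∀ q', I.lower q a q' ≤ ν.real {q'} ∧ ν.real {q'} ≤ I.upper q a q') :
    ∫⁻ q', V q' ∂ν ≤ ∫⁻ q', V q' ∂(I.bestDist q a V).toMeasure :=
  (I.exists_feasible_forall_lintegral_le q a V).choose_spec.2 hV ν inferInstance hν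

/-- The optimal probability, over strategies and adversaries, of acceptance within `n` more steps
after the finite path `h`. -/
noncomputable def optValue (I : IMDP Q A AP) (safe : Set Q) (φ : LTLf AP) :
    ℕ → (k : ℕ) → (Finset.Iic k → Q) → ENNReal
  | 0, k, h => {h | AcceptsBy safe I.label φ k h}.indicator 1 h
  | n + 1, k, h => ⨆ a : A, ∫⁻ q', I.optValue safe φ n (k + 1) (snocState h q')
      ∂(I.bestDist (lastState h) a
        (fun q' => I.optValue safe φ n (k + 1) (snocState h q'))).toMeasure

variable (I : IMDP Q A AP) (safe : Set Q) (φ : LTLf AP)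

theorem optValue_succ (n k : ℕ) (h : Finset.Iic k → Q) :
    I.optValue safe φ (n + 1) k h = ⨆ a : A, ∫⁻ q', I.optValue safe φ n (k + 1) (snocState h q')
      ∂(I.bestDist (lastState h) a
        (fun q' => I.optValue safe φ n (k + 1) (snocState h q'))).toMeasure :=
  rfl

theorem optValue_le_one (n k : ℕ) (h : Finset.Iic k → Q) : I.optValue safe φ n k h ≤ 1 := by
  induction n generalizing k with
  | zero => exact Set.indicator_le_self' (fun _ _ => zero_le) h
  | succ n ih =>
    refine iSup_le (fun a => (lintegral_mono (fun q' => ih (k + 1) _)).trans ?_)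
    simp

theorem optValue_ne_top (n k : ℕ) (h : Finset.Iic k → Q) : I.optValue safe φ n k h ≠ ⊤ :=
  ((I.optValue_le_one safe φ n k h).trans_lt ENNReal.one_lt_top).ne

theorem optValue_zero_snocState (k : ℕ) {h : Finset.Iic k → Q} (hs : ¬ ∀ i, h i ∈ safe) (q' : Q) :
    I.optValue safe φ 0 (k + 1) (snocState h q') = I.optValue safe φ 0 k h := by
  classical
  simp [optValue, Set.indicator_apply, acceptsBy_snocState hs]

/-- Acceptance is frozen after leaving `safe`, so further steps average and maximize a constant. An
action must exist, since the supremum over no actions would be `0`. -/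
theorem optValue_of_not_safe [Nonempty A] (n k : ℕ) {h : Finset.Iic k → Q}
    (hs : ¬ ∀ i, h i ∈ safe) : I.optValue safe φ n k h = I.optValue safe φ 0 k h := by
  induction n generalizing k with
  | zero => rfl
  | succ n ih =>
    have key : ∀ q', I.optValue safe φ n (k + 1) (snocState h q') = I.optValue safe φ 0 k h :=
      fun q' => (ih (k + 1) (not_safe_snocState hs q')).trans (I.optValue_zero_snocState safe φ k hs q')
    rw [optValue_succ]
    simp [key]

/-- One-step Bellman inequality: no action and feasible law can beat the best ones. It is applied to
the abstracted transition laws of the process. -/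
theorem lintegral_le_optValue_succ (n k : ℕ) (h : Finset.Iic k → Q) (a : A) (ν : Measure Q)
    [IsProbabilityMeasure ν]
    (hν : ∀ q', I.lower (lastState h) a q' ≤ ν.real {q'} ∧
      ν.real {q'} ≤ I.upper (lastState h) a q') :
    ∫⁻ q', I.optValue safe φ n (k + 1) (snocState h q') ∂ν ≤ I.optValue safe φ (n + 1) k h := by
  rw [optValue_succ]
  exact (I.lintegral_le_bestDist _ a (fun q' => I.optValue_ne_top safe φ n _ _) ν hν).trans
    (le_iSup (fun a => ∫⁻ q', I.optValue safe φ n (k + 1) (snocState h q')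
      ∂(I.bestDist (lastState h) a
        (fun q' => I.optValue safe φ n (k + 1) (snocState h q'))).toMeasure) a)

theorem exists_optValue_succ_eq [Nonempty A] (n k : ℕ) (h : Finset.Iic k → Q) :
    ∃ a : A, ∫⁻ q', I.optValue safe φ n (k + 1) (snocState h q')
      ∂(I.bestDist (lastState h) a
        (fun q' => I.optValue safe φ n (k + 1) (snocState h q'))).toMeasure =
          I.optValue safe φ (n + 1) k h :=
  exists_eq_ciSup_of_finite

theorem lintegral_optValue_zero (k : ℕ) (μ : Measure (ℕ → Q)) :
    ∫⁻ ω, I.optValue safe φ 0 k (Preorder.frestrictLe (π := fun _ => Q) k ω) ∂μ =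
      μ {ω | AcceptsBy safe I.label φ k (Preorder.frestrictLe (π := fun _ => Q) k ω)} := by
  have hs : MeasurableSet
      {ω : ℕ → Q | AcceptsBy safe I.label φ k (Preorder.frestrictLe (π := fun _ => Q) k ω)} :=
    (Preorder.measurable_frestrictLe (X := fun _ => Q) k)
      (MeasurableSet.of_discrete (s := {h | AcceptsBy safe I.label φ k h}))
  rw [← lintegral_indicator_one hs]
  rfl

variable [MeasurableSpace A] [DiscreteMeasurableSpace A]

/-- The strategy that is optimal, with a cooperating adversary, for the horizon `K`. -/
noncomputable def greedyStrategy [Nonempty A] (K : ℕ) : Strategy Q A where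
  -- After the step at time `k`, `K - (k + 1)` steps remain. Times `k ≥ K`, where the subtraction
  -- truncates, do not affect acceptance by time `K`.
  act k h _ := (I.exists_optValue_succ_eq safe φ (K - (k + 1)) k h).choose
  measurable_act _ := Measurable.of_discrete

/-- The cooperating adversary for the horizon `K`. -/
noncomputable def greedyAdversary (K : ℕ) : I.Adversary where
  dist k h _ a := I.bestDist (lastState h) a
    (fun q' => I.optValue safe φ (K - (k + 1)) (k + 1) (snocState h q'))
  feasible _ _ _ _ := I.feasible_bestDist _ _ _

/-- Under the greedy pair the Bellman inequality is an equality at each step, so the value process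
is a martingale up to the horizon. -/
theorem lintegral_optValue_greedy [Nonempty A] (k n : ℕ) (q : Q) :
    ∫⁻ ω, I.optValue safe φ n k (Preorder.frestrictLe (π := fun _ => Q) k ω)
      ∂(pathMeasure (I.greedyStrategy safe φ (n + k))
        (I.greedyAdversary safe φ (n + k)).transition q) =
      I.optValue safe φ (n + k) 0 (fun _ => q) := by
  -- The horizon `K` is fixed first, so that the path measure stays the same while the induction
  -- trades remaining steps `n` for elapsed steps `k`.
  suffices H : ∀ K k n, n + k = K →
      ∫⁻ ω, I.optValue safe φ n k (Preorder.frestrictLe (π := fun _ => Q) k ω)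
        ∂(pathMeasure (I.greedyStrategy safe φ K) (I.greedyAdversary safe φ K).transition q) =
        I.optValue safe φ K 0 (fun _ => q) from H _ k n rfl
  intro K k
  induction k with
  | zero =>
    rintro n rfl
    exact lintegral_pathMeasure_zero _ _ _ Measurable.of_discrete
  | succ k ih =>
    intro n hn
    rw [lintegral_pathMeasure_succ _ _ _ _ Measurable.of_discrete, ← ih (n + 1) (by lia)]
    refine lintegral_congr (fun ω => ?_)
    obtain rfl : K - (k + 1) = n := by lia
    exact (I.exists_optValue_succ_eq safe φ (K - (k + 1)) k
      (Preorder.frestrictLe (π := fun _ => Q) k ω)).choose_spec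

theorem satProb_le_one (π : Strategy Q A) (ξ : I.Adversary) (q : Q) :
    I.satProb safe φ π ξ q ≤ 1 :=
  measureReal_le_one

theorem satProb_nonneg (π : Strategy Q A) (ξ : I.Adversary) (q : Q) :
    0 ≤ I.satProb safe φ π ξ q :=
  measureReal_nonneg

theorem satProb_le_pUpOpt (π : Strategy Q A) (ξ : I.Adversary) (q : Q) :
    I.satProb safe φ π ξ q ≤ I.pUpOpt safe φ q := by
  have := I.nonempty_adversary
  have h1 : BddAbove (Set.range fun ξ : I.Adversary => I.satProb safe φ π ξ q) :=
    ⟨1, Set.forall_mem_range.2 fun ξ => I.satProb_le_one safe φ π ξ q⟩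
  have h2 : BddAbove (Set.range fun π : Strategy Q A =>
      ⨆ ξ : I.Adversary, I.satProb safe φ π ξ q) :=
    ⟨1, Set.forall_mem_range.2 fun π => ciSup_le fun ξ => I.satProb_le_one safe φ π ξ q⟩
  exact (le_ciSup h1 ξ).trans (le_ciSup h2 π)

/-- The optimal value for a finite horizon is below the optimistic value of the IMDP. -/
theorem optValue_le_pUpOpt [Nonempty A] (K : ℕ) (q : Q) :
    I.optValue safe φ K 0 (fun _ => q) ≤ ENNReal.ofReal (I.pUpOpt safe φ q) := by
  have h := I.lintegral_optValue_greedy safe φ K 0 q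
  rw [Nat.zero_add, lintegral_optValue_zero] at h
  rw [← h]
  -- The greedy pair attains the value as its probability of acceptance by time `K`, which is at
  -- most its probability of satisfaction.
  refine le_trans ?_ (ENNReal.ofReal_le_ofReal (I.satProb_le_pUpOpt safe φ
    (I.greedyStrategy safe φ K) (I.greedyAdversary safe φ K) q))
  rw [satProb, ofReal_measureReal, measure_pathSat_eq_iSup]
  exact le_iSup (fun k => pathMeasure (I.greedyStrategy safe φ K)
    (I.greedyAdversary safe φ K).transition q
      {ω | AcceptsBy safe I.label φ k (Preorder.frestrictLe (π := fun _ => Q) k ω)}) K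

end IMDP

/-! ## The abstracted path of the process -/

namespace Discretization

variable {n m ℓ N : ℕ} {X : Set (EuclideanSpace ℝ (Fin n))}
  {r : Fin ℓ → Set (EuclideanSpace ℝ (Fin n))} (D : Discretization X r N)
  {Sys : SwitchedSystem n m} {I : IMDP (AbsState N) (Fin m) (Fin ℓ)}

theorem z_ne_outside_iff (x : EuclideanSpace ℝ (Fin n)) :
    D.z x ∈ ({AbsState.outside}ᶜ : Set (AbsState N)) ↔ x ∈ X := by
  rw [Set.mem_compl_iff, Set.mem_singleton_iff, AbsState.outside, ← D.mem_region_iff]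
  exact not_not

theorem exists_mem_cell {x : EuclideanSpace ℝ (Fin n)} (hx : D.z x ≠ AbsState.outside) :
    ∃ i, D.z x = AbsState.cell i ∧ x ∈ D.cell i := by
  cases hz : D.z x with
  | none => exact absurd hz hx
  | some i => exact ⟨i, rfl, (D.mem_region_iff x (some i)).2 hz⟩

theorem measurable_path_z : Measurable (fun (ω : ℕ → EuclideanSpace ℝ (Fin n)) i => D.z (ω i)) :=
  measurable_pi_lambda _ fun i => D.measurable_z.comp (measurable_pi_apply i)

theorem measurable_finitePath_z (k : ℕ) :
    Measurable (fun (h : Finset.Iic k → EuclideanSpace ℝ (Fin n)) i => D.z (h i)) :=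
  measurable_pi_lambda _ fun i => D.measurable_z.comp (measurable_pi_apply i)

variable {D}

theorem IsAbstraction.label_z (hI : D.IsAbstraction Sys I) {x : EuclideanSpace ℝ (Fin n)}
    (hx : x ∈ X) : I.label (D.z x) = SwitchedSystem.label r x := by
  obtain ⟨i, hi, hxi⟩ := D.exists_mem_cell ((D.z_ne_outside_iff x).2 hx)
  rw [hi, hI.label_eq i x hxi]

theorem IsAbstraction.pathSat_iff (hI : D.IsAbstraction Sys I) (φ : LTLf (Fin ℓ))
    (ω : ℕ → EuclideanSpace ℝ (Fin n)) :
    PathSat X (SwitchedSystem.label r) φ ω ↔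
      PathSat {AbsState.outside}ᶜ I.label φ (fun i => D.z (ω i)) := by
  refine exists_congr (fun k => ?_)
  simp only [z_ne_outside_iff]
  refine and_congr_left (fun H => ?_)
  have : tracePrefix (SwitchedSystem.label r) ω k = tracePrefix I.label (fun i => D.z (ω i)) k :=
    List.map_congr_left fun i hi =>
      (hI.label_z (H i (Nat.lt_succ_iff.1 (List.mem_range.1 hi)))).symm
  rw [this]

/-- Satisfaction is pulled back from the countable abstract state space, where its measurability is
known. -/
theorem IsAbstraction.measure_pathSat (hI : D.IsAbstraction Sys I) (φ : LTLf (Fin ℓ))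
    (μ : Measure (ℕ → EuclideanSpace ℝ (Fin n))) :
    μ {ω | PathSat X (SwitchedSystem.label r) φ ω} =
      (μ.map fun ω i => D.z (ω i)) {ω | PathSat {AbsState.outside}ᶜ I.label φ ω} := by
  rw [Measure.map_apply D.measurable_path_z measurableSet_pathSat]
  congr 1
  ext ω
  exact hI.pathSat_iff φ ω

instance (p : Fin m × EuclideanSpace ℝ (Fin n)) :
    IsProbabilityMeasure ((Sys.T p).map D.z) :=
  Measure.isProbabilityMeasure_map D.measurable_z.aemeasurable

/-- The abstracted transition probabilities from a point of a cell are feasible. -/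
theorem IsAbstraction.feasible_map_z (hI : D.IsAbstraction Sys I) (u : Fin m)
    {x : EuclideanSpace ℝ (Fin n)} (hx : D.z x ≠ AbsState.outside) (q' : AbsState N) :
    I.lower (D.z x) u q' ≤ ((Sys.T (u, x)).map D.z).real {q'} ∧
      ((Sys.T (u, x)).map D.z).real {q'} ≤ I.upper (D.z x) u q' := by
  obtain ⟨i, hi, hxi⟩ := D.exists_mem_cell hx
  have : D.z ⁻¹' {q'} = D.region q' := Set.ext fun y => (D.mem_region_iff y q').symm
  rw [map_measureReal_apply D.measurable_z (measurableSet_singleton q'), this, hi]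
  exact ⟨hI.lower_le i u q' x hxi, hI.le_upper i u q' x hxi⟩

/-! ## The optimal satisfaction probability of the process -/

/-- Along every strategy of the process, the optimistic value of the abstracted path is a
supermartingale. -/
theorem IsAbstraction.lintegral_optValue_le (hI : D.IsAbstraction Sys I) (φ : LTLf (Fin ℓ))
    (σ : Strategy (EuclideanSpace ℝ (Fin n)) (Fin m)) (x : EuclideanSpace ℝ (Fin n))
    (k j : ℕ) :
    ∫⁻ ω, I.optValue {AbsState.outside}ᶜ φ j k (fun i => D.z (ω i))
      ∂(pathMeasure σ Sys.transition x) ≤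
        I.optValue {AbsState.outside}ᶜ φ (j + k) 0 (fun _ => D.z x) := by
  have hmeas : ∀ j k, Measurable (fun h : Finset.Iic k → EuclideanSpace ℝ (Fin n) =>
      I.optValue {AbsState.outside}ᶜ φ j k (fun i => D.z (h i))) := fun j k =>
    (Measurable.of_discrete (f := I.optValue {AbsState.outside}ᶜ φ j k)).comp
      (D.measurable_finitePath_z k)
  induction k generalizing j with
  | zero => exact (lintegral_pathMeasure_zero _ _ _ (hmeas j 0)).le
  | succ k ih =>
    refine le_trans ?_ ((ih (j + 1)).trans_eq (by rw [add_assoc, add_comm 1 k]))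
    refine (lintegral_pathMeasure_succ _ _ _ _ (hmeas j (k + 1))).trans_le
      (lintegral_mono fun ω => ?_)
    let h := Preorder.frestrictLe (π := fun _ => EuclideanSpace ℝ (Fin n)) k ω
    let u := σ.act k h (σ.pastActions k h)
    have : Nonempty (Fin m) := ⟨u⟩
    have hstep : ∫⁻ y, I.optValue {AbsState.outside}ᶜ φ j (k + 1) (fun i => D.z (snocState h y i))
        ∂(Sys.T (u, lastState h)) =
        ∫⁻ q', I.optValue {AbsState.outside}ᶜ φ j (k + 1) (snocState (fun i => D.z (h i)) q')
          ∂((Sys.T (u, lastState h)).map D.z) := by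
      rw [lintegral_map Measurable.of_discrete D.measurable_z]
      simp only [comp_snocState]
    refine hstep.trans_le ?_
    -- Outside `X` the true transition law need not be feasible for the absorbing abstract state,
    -- but there the value no longer depends on the next state.
    by_cases hx : D.z (lastState h) = AbsState.outside
    · have hs : ¬ ∀ i, (fun i => D.z (h i)) i ∈ ({AbsState.outside}ᶜ : Set (AbsState N)) :=
        fun H => H ⟨k, Finset.mem_Iic.2 le_rfl⟩ hx
      change _ ≤ I.optValue {AbsState.outside}ᶜ φ (j + 1) k (fun i => D.z (h i))
      rw [I.optValue_of_not_safe _ _ _ _ hs]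
      have key : ∀ q', I.optValue {AbsState.outside}ᶜ φ j (k + 1)
          (snocState (fun i => D.z (h i)) q') =
            I.optValue {AbsState.outside}ᶜ φ 0 k (fun i => D.z (h i)) := fun q' =>
        (I.optValue_of_not_safe _ _ _ _ (not_safe_snocState hs q')).trans
          (I.optValue_zero_snocState _ _ _ hs q')
      simp [key]
    · exact I.lintegral_le_optValue_succ _ φ j k (fun i => D.z (h i)) u _
        (hI.feasible_map_z u hx)

/-- The probability of acceptance by time `k` is the expected value with no steps left. The
supermartingale bounds it by the initial value for horizon `k`, and hence by a bound uniform in `k`.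
-/
theorem IsAbstraction.satProb_le_pUpOpt (hI : D.IsAbstraction Sys I) (φ : LTLf (Fin ℓ))
    (σ : Strategy (EuclideanSpace ℝ (Fin n)) (Fin m)) (x : EuclideanSpace ℝ (Fin n)) :
    Sys.satProb X r φ σ x ≤ I.pUpOpt {AbsState.outside}ᶜ φ (D.z x) := by
  have : Nonempty (Fin m) := ⟨σ.act 0 (fun _ => x) Fin.elim0⟩
  have h0 : 0 ≤ I.pUpOpt {AbsState.outside}ᶜ φ (D.z x) :=
    Real.iSup_nonneg fun π => Real.iSup_nonneg fun ξ => I.satProb_nonneg _ φ π ξ _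
  refine ENNReal.toReal_le_of_le_ofReal h0 ?_
  rw [hI.measure_pathSat, measure_pathSat_eq_iSup]
  refine iSup_le fun k => ?_
  have hm : Measurable (fun ω : ℕ → AbsState N => I.optValue {AbsState.outside}ᶜ φ 0 k
      (Preorder.frestrictLe (π := fun _ => AbsState N) k ω)) :=
    (Measurable.of_discrete (f := I.optValue {AbsState.outside}ᶜ φ 0 k)).comp
      (Preorder.measurable_frestrictLe (X := fun _ => AbsState N) k)
  rw [← I.lintegral_optValue_zero, lintegral_map hm D.measurable_path_z]
  exact (hI.lintegral_optValue_le φ σ x k 0).trans (I.optValue_le_pUpOpt _ φ _ _)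

end Discretization

/-! ## Finite-dimensional laws of the path measure -/

section PathMeasure

variable {S A : Type} [MeasurableSpace S] [MeasurableSpace A] (π : Strategy S A)
  (κ : (k : ℕ) → Kernel ((Finset.Iic k → S) × (Fin k → A) × A) S) [∀ k, IsMarkovKernel (κ k)]
  (x₀ : S)

theorem pathMeasure_frestrictLe_zero_mem {s : Set (Finset.Iic 0 → S)} (hs : MeasurableSet s) :
    pathMeasure π κ x₀ {ω | Preorder.frestrictLe (π := fun _ => S) 0 ω ∈ s} =
      s.indicator 1 (fun _ => x₀) := by
  have hs' : MeasurableSet {ω : ℕ → S | Preorder.frestrictLe (π := fun _ => S) 0 ω ∈ s} :=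
    Preorder.measurable_frestrictLe (X := fun _ => S) 0 hs
  rw [← lintegral_pathMeasure_zero π κ x₀ (measurable_one.indicator hs),
    ← lintegral_indicator_one hs']
  rfl

theorem pathMeasure_frestrictLe_succ_mem (k : ℕ) {s : Set (Finset.Iic (k + 1) → S)}
    (hs : MeasurableSet s) :
    pathMeasure π κ x₀ {ω | Preorder.frestrictLe (π := fun _ => S) (k + 1) ω ∈ s} =
      ∫⁻ ω, κ k (π.decision k (Preorder.frestrictLe (π := fun _ => S) k ω))
        {y | snocState (Preorder.frestrictLe (π := fun _ => S) k ω) y ∈ s}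
          ∂(pathMeasure π κ x₀) := by
  have hs' : MeasurableSet {ω : ℕ → S | Preorder.frestrictLe (π := fun _ => S) (k + 1) ω ∈ s} :=
    Preorder.measurable_frestrictLe (X := fun _ => S) (k + 1) hs
  have hsnoc : ∀ h : Finset.Iic k → S, MeasurableSet {y | snocState h y ∈ s} := fun h =>
    (measurable_snocState.comp measurable_prodMk_left) hs
  rw [← lintegral_indicator_one hs']
  refine (lintegral_pathMeasure_succ π κ x₀ k (measurable_one.indicator hs)).trans
    (lintegral_congr fun ω => ?_)
  rw [← lintegral_indicator_one (hsnoc _)]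
  rfl

end PathMeasure

/-! ## The adversary that reproduces the process -/

namespace Discretization

variable {n m ℓ N : ℕ} {X : Set (EuclideanSpace ℝ (Fin n))}
  {r : Fin ℓ → Set (EuclideanSpace ℝ (Fin n))} {D : Discretization X r N}
  {Sys : SwitchedSystem n m} {I : IMDP (AbsState N) (Fin m) (Fin ℓ)}

/-- The refined strategy sees only abstract states, so its actions are constant on each cylinder.
This is what lets one adversary distribution per abstract path describe the process. -/
theorem pastActions_refine (π : Strategy (AbsState N) (Fin m)) (k : ℕ)
    (h : Finset.Iic k → EuclideanSpace ℝ (Fin n)) :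
    (D.refine π).pastActions k h = π.pastActions k (fun i => D.z (h i)) := by
  induction k with
  | zero => rfl
  | succ k ih =>
    simp only [Strategy.pastActions, ih]
    rfl

theorem decision_refine (π : Strategy (AbsState N) (Fin m)) (k : ℕ)
    (h : Finset.Iic k → EuclideanSpace ℝ (Fin n)) :
    (D.refine π).decision k h = (h, (π.decision k (fun i => D.z (h i))).2) := by
  rw [Strategy.decision, pastActions_refine]
  rfl

variable (D)

/-- The paths of the process whose first `k` steps are abstracted to `h`. -/
def cylinder (k : ℕ) (h : Finset.Iic k → AbsState N) : Set (ℕ → EuclideanSpace ℝ (Fin n)) :=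
  {ω | (fun i : Finset.Iic k => D.z (ω i)) = h}

theorem measurableSet_cylinder (k : ℕ) (h : Finset.Iic k → AbsState N) :
    MeasurableSet (D.cylinder k h) :=
  (measurable_pi_lambda _ fun i => D.measurable_z.comp (measurable_pi_apply i.1) :
    Measurable fun (ω : ℕ → EuclideanSpace ℝ (Fin n)) (i : Finset.Iic k) => D.z (ω i))
      (measurableSet_singleton h)

theorem map_z_cylinder (μ : Measure (ℕ → EuclideanSpace ℝ (Fin n))) (k : ℕ)
    (h : Finset.Iic k → AbsState N) :
    (μ.map fun ω i => D.z (ω i))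
      {ω | Preorder.frestrictLe (π := fun _ => AbsState N) k ω = h} = μ (D.cylinder k h) :=
  Measure.map_apply D.measurable_path_z (measurableSet_frestrictLe_eq k h)

variable {D}

/-- The mean of the transition probabilities over a cylinder of positive probability is
feasible. -/
theorem IsAbstraction.exists_feasible_mean (hI : D.IsAbstraction Sys I)
    (μ : Measure (ℕ → EuclideanSpace ℝ (Fin n))) [IsProbabilityMeasure μ] (k : ℕ)
    (h : Finset.Iic k → AbsState N) (u : Fin m) :
    ∃ d : PMF (AbsState N), I.Feasible (lastState h) u d ∧
      (lastState h ≠ AbsState.outside → ∀ q', μ (D.cylinder k h) * d q' =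
        ∫⁻ ω in D.cylinder k h, (Sys.T (u, ω k)).map D.z {q'} ∂μ) := by
  -- On a null cylinder both sides of the identity vanish, and at `outside` nothing is claimed; any
  -- feasible distribution serves in these cases.
  by_cases hc : lastState h ≠ AbsState.outside ∧ μ (D.cylinder k h) ≠ 0
  · obtain ⟨hs, h0⟩ := hc
    have : IsProbabilityMeasure (μ[|D.cylinder k h]) := cond_isProbabilityMeasure h0
    let κ : Kernel (ℕ → EuclideanSpace ℝ (Fin n)) (AbsState N) :=
      (Sys.T.map D.z).comap (fun ω => (u, ω k))
        (measurable_const.prodMk (measurable_pi_apply k))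
    have hκ : ∀ ω, κ ω = (Sys.T (u, ω k)).map D.z := fun ω =>
      Kernel.map_apply _ D.measurable_z _
    have : IsMarkovKernel κ := ⟨fun ω => by rw [hκ]; infer_instance⟩
    -- The mixture of the abstracted transition laws under the process conditioned on the cylinder.
    -- Almost surely `ω k` lies in the cell `lastState h`, so the bounds hold pointwise and survive
    -- integration.
    let ν : Measure (AbsState N) := (μ[|D.cylinder k h]).bind κ
    have hν : ∀ q', ν {q'} = ∫⁻ ω, (Sys.T (u, ω k)).map D.z {q'} ∂(μ[|D.cylinder k h]) :=
      fun q' => by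
        rw [Measure.bind_apply (measurableSet_singleton q') κ.measurable.aemeasurable]
        simp only [hκ]
    have hcyl : ∀ᵐ ω ∂(μ[|D.cylinder k h]), D.z (ω k) = lastState h := by
      filter_upwards [ae_cond_mem (D.measurableSet_cylinder k h)] with ω hω
      exact congrFun hω ⟨k, Finset.mem_Iic.2 le_rfl⟩
    have hfeas : ∀ᵐ ω ∂(μ[|D.cylinder k h]), ∀ q',
        ENNReal.ofReal (I.lower (lastState h) u q') ≤ (Sys.T (u, ω k)).map D.z {q'} ∧
          (Sys.T (u, ω k)).map D.z {q'} ≤ ENNReal.ofReal (I.upper (lastState h) u q') := by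
      filter_upwards [hcyl] with ω hω q'
      have := hI.feasible_map_z u (x := ω k) (by rwa [hω]) q'
      rw [hω] at this
      rw [← ofReal_measureReal (μ := (Sys.T (u, ω k)).map D.z)]
      exact ⟨ENNReal.ofReal_le_ofReal this.1, ENNReal.ofReal_le_ofReal this.2⟩
    refine ⟨ν.toPMF, fun q' => ⟨?_, ?_⟩, fun _ q' => ?_⟩
    · rw [Measure.toPMF_apply, hν]
      refine (ENNReal.ofReal_le_iff_le_toReal ?_).1 ?_
      · rw [← hν]; exact measure_ne_top ν _
      · simpa using lintegral_mono_ae (hfeas.mono fun ω hω => (hω q').1)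
    · rw [Measure.toPMF_apply, hν]
      refine ENNReal.toReal_le_of_le_ofReal
        ((I.lower_nonneg _ _ _).trans (I.lower_le_upper _ _ _)) ?_
      simpa using lintegral_mono_ae (hfeas.mono fun ω hω => (hω q').2)
    -- Multiplying by the probability of the cylinder cancels the normalization of the conditional
    -- measure.
    · rw [Measure.toPMF_apply, hν, ProbabilityTheory.cond, lintegral_smul_measure, smul_eq_mul,
        ← mul_assoc, ENNReal.mul_inv_cancel h0 (measure_ne_top μ _), one_mul]
  · obtain ⟨d, hd⟩ := I.exists_feasible (lastState h) u
    refine ⟨d, hd, fun hs q' => ?_⟩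
    have h0 : μ (D.cylinder k h) = 0 := by_contra fun h0 => hc ⟨hs, h0⟩
    rw [h0, zero_mul, setLIntegral_measure_zero _ _ h0]

/-- Some adversary gives every safe abstract finite path the probability that the process gives
it. -/
theorem IsAbstraction.exists_adversary_measure_cylinder (hI : D.IsAbstraction Sys I)
    (π : Strategy (AbsState N) (Fin m)) (x : EuclideanSpace ℝ (Fin n)) :
    ∃ ξ : I.Adversary, ∀ k (h : Finset.Iic k → AbsState N),
      (∀ i, h i ∈ ({AbsState.outside}ᶜ : Set (AbsState N))) →
        pathMeasure (D.refine π) Sys.transition x (D.cylinder k h) =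
          pathMeasure π ξ.transition (D.z x)
            {ω | Preorder.frestrictLe (π := fun _ => AbsState N) k ω = h} := by
  let μ := pathMeasure (D.refine π) Sys.transition x
  -- The adversary depends on `x` and `π` through `μ`. It may ignore the past actions, since under
  -- `π` the abstract states determine them.
  let ξ : I.Adversary :=
    { dist := fun k h _ u => (hI.exists_feasible_mean μ k h u).choose
      feasible := fun k h _ u => (hI.exists_feasible_mean μ k h u).choose_spec.1 }
  refine ⟨ξ, fun k => ?_⟩
  induction k with
  | zero =>
    intro h _
    refine (pathMeasure_frestrictLe_zero_mem (D.refine π) Sys.transition x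
      (D.measurable_finitePath_z 0 (measurableSet_singleton h))).trans (Eq.trans ?_
        (pathMeasure_frestrictLe_zero_mem π ξ.transition (D.z x)
          (measurableSet_singleton h)).symm)
    rfl
  | succ k ih =>
    intro h hs
    have hs' : ∀ i, dropLastState h i ∈ ({AbsState.outside}ᶜ : Set (AbsState N)) :=
      fun i => hs _
    let u := π.act k (dropLastState h) (π.pastActions k (dropLastState h))
    -- On the cylinder of the shortened path the process always plays `u`, so reaching `h` means
    -- that the next state falls into the region of `lastState h`.
    have hleft : μ (D.cylinder (k + 1) h) =
        ∫⁻ ω in D.cylinder k (dropLastState h), (Sys.T (u, ω k)).map D.z {lastState h} ∂μ := by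
      rw [← lintegral_indicator (D.measurableSet_cylinder k _)]
      refine (pathMeasure_frestrictLe_succ_mem (D.refine π) Sys.transition x k
        (D.measurable_finitePath_z (k + 1) (measurableSet_singleton h))).trans
          (lintegral_congr fun ω => ?_)
      simp only [Set.mem_preimage, Set.mem_singleton_iff, comp_snocState, snocState_eq_iff]
      by_cases hω : ω ∈ D.cylinder k (dropLastState h)
      · rw [Set.indicator_of_mem hω, Measure.map_apply D.measurable_z (measurableSet_singleton _)]
        have hω' : (fun i => D.z (Preorder.frestrictLe
            (π := fun _ => EuclideanSpace ℝ (Fin n)) k ω i)) = dropLastState h := hω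
        rw [decision_refine, hω']
        simp only [true_and]
        rfl
      · have hω' : (fun i => D.z (Preorder.frestrictLe
            (π := fun _ => EuclideanSpace ℝ (Fin n)) k ω i)) ≠ dropLastState h := hω
        simp only [Set.indicator_of_notMem hω, hω', false_and]
        exact measure_empty
    have hright : pathMeasure π ξ.transition (D.z x)
        {ω | Preorder.frestrictLe (π := fun _ => AbsState N) (k + 1) ω = h} =
          pathMeasure π ξ.transition (D.z x)
            {ω | Preorder.frestrictLe (π := fun _ => AbsState N) k ω = dropLastState h} *
              ξ.dist k (dropLastState h) (π.pastActions k (dropLastState h)) u (lastState h) := by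
      rw [mul_comm, ← lintegral_indicator_const (measurableSet_frestrictLe_eq k _)]
      refine (pathMeasure_frestrictLe_succ_mem π ξ.transition (D.z x) k
        (measurableSet_singleton h)).trans (lintegral_congr fun ω => ?_)
      simp only [Set.mem_singleton_iff, snocState_eq_iff]
      by_cases hω : ω ∈ {ω | Preorder.frestrictLe (π := fun _ => AbsState N) k ω = dropLastState h}
      · rw [Set.indicator_of_mem hω, show Preorder.frestrictLe k ω = dropLastState h from hω]
        simp only [true_and]
        exact PMF.toMeasure_apply_singleton _ _ (measurableSet_singleton (lastState h))
      · simp only [Set.indicator_of_notMem hω,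
          show Preorder.frestrictLe k ω ≠ dropLastState h from hω, false_and]
        exact measure_empty
    change μ (D.cylinder (k + 1) h) = _
    rw [hleft, hright, ← ih _ hs']
    exact ((hI.exists_feasible_mean μ k (dropLastState h) u).choose_spec.2
      (hs' ⟨k, Finset.mem_Iic.2 le_rfl⟩) (lastState h)).symm

theorem IsAbstraction.exists_adversary_satProb_eq (hI : D.IsAbstraction Sys I)
    (φ : LTLf (Fin ℓ)) (π : Strategy (AbsState N) (Fin m)) (x : EuclideanSpace ℝ (Fin n)) :
    ∃ ξ : I.Adversary, Sys.satProb X r φ (D.refine π) x =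
      I.satProb {AbsState.outside}ᶜ φ π ξ (D.z x) := by
  obtain ⟨ξ, hξ⟩ := hI.exists_adversary_measure_cylinder π x
  refine ⟨ξ, congrArg ENNReal.toReal ?_⟩
  rw [hI.measure_pathSat]
  exact measure_pathSat_congr fun k h hs => (D.map_z_cylinder _ k h).trans (hξ k h hs)

end Discretization

theorem theorem2 {n m ℓ N : ℕ} (Sys : SwitchedSystem n m)
    (X : Set (EuclideanSpace ℝ (Fin n))) (hX : IsCompact X)
    (r : Fin ℓ → Set (EuclideanSpace ℝ (Fin n))) (hr : ∀ i, IsClosed (r i) ∧ r i ⊆ X)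
    (φ : LTLf (Fin ℓ)) (D : Discretization X r N)
    (I : IMDP (AbsState N) (Fin m) (Fin ℓ)) (hI : D.IsAbstraction Sys I)
    (π : Strategy (AbsState N) (Fin m))
    (hπ : I.IsRobustOptimal {AbsState.outside}ᶜ φ π) (x : EuclideanSpace ℝ (Fin n)) :
    Sys.satProb X r φ (D.refine π) x ∈
        Set.Icc (I.pLow {AbsState.outside}ᶜ φ π (D.z x)) (I.pUp {AbsState.outside}ᶜ φ π (D.z x)) ∧
      |Sys.satProb X r φ (D.refine π) x - Sys.optProb X r φ x| ≤
        I.pUpOpt {AbsState.outside}ᶜ φ (D.z x) - I.pLow {AbsState.outside}ᶜ φ π (D.z x) := by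
  obtain ⟨ξ, hξ⟩ := hI.exists_adversary_satProb_eq φ π x
  have hlow : I.pLow {AbsState.outside}ᶜ φ π (D.z x) ≤ Sys.satProb X r φ (D.refine π) x :=
    hξ ▸ ciInf_le ⟨0, Set.forall_mem_range.2 fun ξ => I.satProb_nonneg _ φ π ξ _⟩ ξ
  have hup : Sys.satProb X r φ (D.refine π) x ≤ I.pUp {AbsState.outside}ᶜ φ π (D.z x) :=
    hξ ▸ le_ciSup (f := fun ξ => I.satProb {AbsState.outside}ᶜ φ π ξ (D.z x))
      ⟨1, Set.forall_mem_range.2 fun ξ => I.satProb_le_one _ φ π ξ _⟩ ξ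
  have : Nonempty (Strategy (EuclideanSpace ℝ (Fin n)) (Fin m)) := ⟨D.refine π⟩
  have hopt : Sys.optProb X r φ x ≤ I.pUpOpt {AbsState.outside}ᶜ φ (D.z x) :=
    ciSup_le fun σ => hI.satProb_le_pUpOpt φ σ x
  have hle : Sys.satProb X r φ (D.refine π) x ≤ Sys.optProb X r φ x :=
    le_ciSup (f := fun σ => Sys.satProb X r φ σ x)
      ⟨1, Set.forall_mem_range.2 fun _ => measureReal_le_one⟩ (D.refine π)
  refine ⟨⟨hlow, hup⟩, ?_⟩
  -- The refined strategy is itself a competitor for `p*`, so the difference has a known sign.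
  rw [abs_sub_comm, abs_of_nonneg (sub_nonneg.2 hle)]
  exact sub_le_sub hopt hlow
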